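/- Let $n$ be a natural number and let $A$ be an $n\times n$ integer matrix that is expanding, i.e. every complex eigenvalue of $A$ has modulus greater than $1$. Let $D\subset\mathbb{Z}^n$ be a nonempty finite set. Then there is a unique nonempty compact set $T=T(A,D)\subset\mathbb{R}^n$ (the self-affine set of $A$ and $D$) satisfying $$A(T)=\bigcup_{d\in D}(T+d),$$ and its Lebesgue measure $\lambda(T)$ is a (finite, nonnegative) rational number. -/

import Mathlib

open MeasureTheory

/-- An integer matrix is expanding if each of its complex eigenvalues has modulus greater
than `1`. -/
def IsExpanding {n : ℕ} (A : Matrix (Fin n) (Fin n) ℤ) : Prop :=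
  ∀ μ ∈ spectrum ℂ (A.map (Int.cast : ℤ → ℂ)), 1 < ‖μ‖

/-- `T` is a nonempty compact subset of `ℝⁿ` satisfying `A(T) = ⋃_{d ∈ D} (T + d)`. -/
structure IsSelfAffineSet {n : ℕ} (A : Matrix (Fin n) (Fin n) ℤ) (D : Finset (Fin n → ℤ))
    (T : Set (Fin n → ℝ)) : Prop where
  nonempty : T.Nonempty
  isCompact : IsCompact T
  image_eq : (fun x => (A.map (Int.cast : ℤ → ℝ)).mulVec x) '' T =
    ⋃ d ∈ D, (fun x => x + fun i => (d i : ℝ)) '' T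

/-! Existence and uniqueness: since `A` expands, the powers of its inverse have summable norms. A
self-affine set is then exactly the set of all sums of `A⁻ᵏ⁻¹ d_k` with digits in `D`, a continuous
image of the compact space of digit sequences.

Rationality: call the set of integer `z` with `x + z ∈ T` the pattern of `x`. The equation for `T`
makes the pattern at `x` a function of the pattern at `A x`. As `A` multiplies volume by `|det A|`,
the volumes of the nonempty patterns solve a homogeneous linear system with integer coefficients
(`exists_patternVolume_eq_sum`). If `T` is not null, counting over `ℤⁿ` adds one inhomogeneous
rational equation (`sum_patternVolume_div_card`).

It remains to see that solutions are proportional. A `ℚ`-linear functional `L` of the volumes solves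
the homogeneous system again. Subtracting the least ratio times the volumes gives a nonnegative
solution that vanishes at a pattern of positive volume, and ergodicity of `A` on the torus
(`volume_eq_zero_or_compl`) forces it to vanish everywhere. Hence `L` acts on the volumes as a
scalar. For a projection of `ℝ` onto `ℚ` the inhomogeneous equation makes this scalar `1`, so every
volume is rational, and `volume T` is a finite sum of them. -/

/-! ### Contraction by the inverse matrix and digit expansions -/

section Expanding

attribute [local instance] Matrix.linftyOpNormedRing Matrix.linftyOpNormedAlgebra

/-- The real matrix with the same entries as an integer matrix. -/
abbrev realMatrix {n : ℕ} (A : Matrix (Fin n) (Fin n) ℤ) : Matrix (Fin n) (Fin n) ℝ :=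
  A.map (Int.cast : ℤ → ℝ)

theorem spectralRadius_lt_one_of_forall {n : ℕ} (C : Matrix (Fin n) (Fin n) ℂ)
    (h : ∀ μ ∈ spectrum ℂ C, ‖μ‖ < 1) : spectralRadius ℂ C < 1 := by
  rcases (spectrum ℂ C).eq_empty_or_nonempty with h0 | h0
  · simp [spectralRadius, h0]
  · exact spectrum.spectralRadius_lt_of_forall_lt_of_nonempty (r := 1) h0
      (fun k hk => by simpa [← NNReal.coe_lt_coe] using h k hk)

/-- Gelfand's formula bounds the norms eventually by a geometric series. -/
theorem summable_norm_pow_of_spectralRadius_lt_one {R : Type*} [NormedRing R]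
    [NormedAlgebra ℂ R] [CompleteSpace R] (a : R) (h : spectralRadius ℂ a < 1) :
    Summable fun k : ℕ => ‖a ^ k‖ := by
  obtain ⟨r, hr, hr1⟩ := ENNReal.lt_iff_exists_nnreal_btwn.1 h
  have hr1' : r < 1 := by exact_mod_cast hr1
  have ht := spectrum.pow_nnnorm_pow_one_div_tendsto_nhds_spectralRadius a
  have hev := (ht.eventually_lt_const hr).and (Filter.eventually_gt_atTop 0)
  refine Summable.of_norm_bounded_eventually_nat (g := fun k => (r : ℝ) ^ k)
    (summable_geometric_of_lt_one r.2 hr1') ?_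
  filter_upwards [hev] with k hk
  obtain ⟨hk, hk0⟩ := hk
  have hk0' : (0 : ℝ) < k := by exact_mod_cast hk0
  have h2 := ENNReal.rpow_le_rpow hk.le hk0'.le
  rw [← ENNReal.rpow_mul, one_div, inv_mul_cancel₀ hk0'.ne', ENNReal.rpow_one,
    ENNReal.rpow_natCast] at h2
  have h3 : ‖a ^ k‖₊ ≤ r ^ k := by exact_mod_cast h2
  rw [norm_norm]
  exact_mod_cast h3

variable {n : ℕ} {A : Matrix (Fin n) (Fin n) ℤ}

theorem IsExpanding.det_ne_zero (hA : IsExpanding A) : A.det ≠ 0 := by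
  intro h0
  have h : (0 : ℂ) ∈ spectrum ℂ (A.map (Int.cast : ℤ → ℂ)) := by
    rw [spectrum.zero_mem_iff, Matrix.isUnit_iff_isUnit_det, isUnit_iff_ne_zero, not_not]
    have := (Int.castRingHom ℂ).map_det A
    rw [h0, map_zero] at this
    exact this.symm
  have := hA 0 h
  norm_num at this

theorem det_realMatrix (A : Matrix (Fin n) (Fin n) ℤ) : (realMatrix A).det = (A.det : ℝ) :=
  ((Int.castRingHom ℝ).map_det A).symm

theorem IsExpanding.isUnit_det_realMatrix (hA : IsExpanding A) :
    IsUnit (realMatrix A).det := by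
  rw [det_realMatrix, isUnit_iff_ne_zero]
  exact_mod_cast hA.det_ne_zero

/-- Over `ℂ` the spectrum of the inverse consists of reciprocals of eigenvalues, so its spectral
radius is below `1`. The estimate descends to `ℝ` because the operator norm used depends only on the
absolute values of the entries. -/
theorem IsExpanding.summable_norm_inv_pow (hA : IsExpanding A) :
    Summable fun k : ℕ => ‖(realMatrix A)⁻¹ ^ k‖ := by
  have hC : IsUnit (A.map (Int.cast : ℤ → ℂ)) := by
    rw [Matrix.isUnit_iff_isUnit_det, isUnit_iff_ne_zero]
    have := (Int.castRingHom ℂ).map_det A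
    rw [show A.map (Int.cast : ℤ → ℂ) = (Int.castRingHom ℂ).mapMatrix A from rfl, ← this]
    simpa using hA.det_ne_zero
  obtain ⟨u, hu⟩ := hC
  have hmap : (realMatrix A)⁻¹.map (algebraMap ℝ ℂ) = ((u⁻¹ : _ˣ) : Matrix (Fin n) (Fin n) ℂ) := by
    rw [Matrix.coe_units_inv, hu]
    symm
    apply Matrix.inv_eq_left_inv
    have : A.map (Int.cast : ℤ → ℂ) = (realMatrix A).map (algebraMap ℝ ℂ) := by
      ext i j; simp
    rw [this, ← Matrix.map_mul, Matrix.nonsing_inv_mul _ hA.isUnit_det_realMatrix]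
    simp
  have hsr : spectralRadius ℂ ((u⁻¹ : _ˣ) : Matrix (Fin n) (Fin n) ℂ) < 1 := by
    apply spectralRadius_lt_one_of_forall
    intro μ hμ
    have hμ0 : μ ≠ 0 := by
      rintro rfl
      exact spectrum.zero_mem_iff ℂ |>.1 hμ (u⁻¹).isUnit
    have h1 : (((Units.mk0 μ hμ0)⁻¹ : ℂˣ) : ℂ) ∈ spectrum ℂ (u : Matrix (Fin n) (Fin n) ℂ) := by
      rw [spectrum.inv_mem_iff]
      simpa using hμ
    rw [hu] at h1
    have h2 := hA _ h1
    simp only [Units.val_inv_eq_inv_val, Units.val_mk0, norm_inv] at h2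
    exact (one_lt_inv₀ (norm_pos_iff.2 hμ0)).1 h2
  have := summable_norm_pow_of_spectralRadius_lt_one _ hsr
  refine this.congr fun k => ?_
  rw [← hmap]
  have : ((realMatrix A)⁻¹.map (algebraMap ℝ ℂ)) ^ k =
      ((realMatrix A)⁻¹ ^ k).map (algebraMap ℝ ℂ) :=
    (map_pow (algebraMap ℝ ℂ).mapMatrix _ _).symm
  rw [this]
  simp [Matrix.linfty_opNorm_def]

theorem IsExpanding.tendsto_inv_pow_mulVec (hA : IsExpanding A) {u : ℕ → Fin n → ℝ} {R : ℝ}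
    (hu : ∀ k, ‖u k‖ ≤ R) :
    Filter.Tendsto (fun k : ℕ => ((realMatrix A)⁻¹ ^ k).mulVec (u k)) Filter.atTop (nhds 0) := by
  refine squeeze_zero_norm (a := fun k => ‖(realMatrix A)⁻¹ ^ k‖ * R) (fun k => ?_) ?_
  · exact (Matrix.linfty_opNorm_mulVec _ _).trans
      (mul_le_mul_of_nonneg_left (hu k) (norm_nonneg _))
  · simpa using hA.summable_norm_inv_pow.tendsto_atTop_zero.mul_const R

/-- The point `∑ A⁻ᵏ⁻¹ d_k` with digit sequence `d`. -/
noncomputable def digitSum (A : Matrix (Fin n) (Fin n) ℤ) (D : Finset (Fin n → ℤ)) (d : ℕ → D) :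
    Fin n → ℝ :=
  ∑' k, ((realMatrix A)⁻¹ ^ (k + 1)).mulVec (fun i => ((d k : Fin n → ℤ) i : ℝ))

theorem exists_norm_digit_le (D : Finset (Fin n → ℤ)) :
    ∃ R : ℝ, ∀ d ∈ D, ‖(fun i => (d i : ℝ))‖ ≤ R := by
  obtain ⟨R, hR⟩ := (D.image fun d => ‖(fun i => (d i : ℝ))‖).bddAbove
  exact ⟨R, fun d hd => hR (by simpa using ⟨d, hd, rfl⟩)⟩

theorem IsExpanding.exists_summable_bound (hA : IsExpanding A) (D : Finset (Fin n → ℤ)) :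
    ∃ b : ℕ → ℝ, Summable b ∧ ∀ (k : ℕ) (d : D),
      ‖((realMatrix A)⁻¹ ^ (k + 1)).mulVec (fun i => ((d : Fin n → ℤ) i : ℝ))‖ ≤ b k := by
  obtain ⟨R, hR⟩ := exists_norm_digit_le D
  refine ⟨fun k => ‖(realMatrix A)⁻¹ ^ (k + 1)‖ * R,
    ((summable_nat_add_iff 1).2 hA.summable_norm_inv_pow).mul_right R, fun k d => ?_⟩
  exact (Matrix.linfty_opNorm_mulVec _ _).trans
    (mul_le_mul_of_nonneg_left (hR _ d.2) (norm_nonneg _))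

theorem IsExpanding.continuous_digitSum (hA : IsExpanding A) (D : Finset (Fin n → ℤ)) :
    Continuous (digitSum A D) := by
  obtain ⟨b, hb, hle⟩ := hA.exists_summable_bound D
  refine continuous_tsum (fun k => ?_) hb (fun k d => hle k (d k))
  have : Continuous fun e : D =>
      ((realMatrix A)⁻¹ ^ (k + 1)).mulVec (fun i => ((e : Fin n → ℤ) i : ℝ)) :=
    continuous_of_discreteTopology
  exact this.comp (continuous_apply k)

theorem IsExpanding.summable_digits (hA : IsExpanding A) {D : Finset (Fin n → ℤ)} (d : ℕ → D) :
    Summable fun k => ((realMatrix A)⁻¹ ^ (k + 1)).mulVec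
      (fun i => ((d k : Fin n → ℤ) i : ℝ)) := by
  obtain ⟨b, hb, hle⟩ := hA.exists_summable_bound D
  exact hb.of_norm_bounded (fun k => hle k (d k))

theorem IsExpanding.mulVec_digitSum (hA : IsExpanding A) {D : Finset (Fin n → ℤ)} (d : ℕ → D) :
    (realMatrix A).mulVec (digitSum A D d) =
      digitSum A D (fun k => d (k + 1)) + fun i => ((d 0 : Fin n → ℤ) i : ℝ) := by
  have hcont : Continuous (realMatrix A).mulVecLin :=
    LinearMap.continuous_of_finiteDimensional _
  have hcancel : ∀ (k : ℕ) (v : Fin n → ℝ), (realMatrix A).mulVec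
      (((realMatrix A)⁻¹ ^ (k + 1)).mulVec v) = ((realMatrix A)⁻¹ ^ k).mulVec v := by
    intro k v
    rw [Matrix.mulVec_mulVec, pow_succ', ← mul_assoc,
      Matrix.mul_nonsing_inv _ hA.isUnit_det_realMatrix, one_mul]
  have h1 := ((hA.summable_digits d).hasSum.map (realMatrix A).mulVecLin hcont).tsum_eq
  simp only [Function.comp_def, Matrix.mulVecLin_apply, hcancel] at h1
  have h2 := (hA.summable_digits d).map (realMatrix A).mulVecLin hcont
  simp only [Function.comp_def, Matrix.mulVecLin_apply, hcancel] at h2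
  rw [digitSum, ← h1, h2.tsum_eq_zero_add, digitSum, add_comm]
  simp

theorem mulVec_inv_mulVec {B : Matrix (Fin n) (Fin n) ℝ} (hB : IsUnit B.det) (v : Fin n → ℝ) :
    B.mulVec (B⁻¹.mulVec v) = v := by
  rw [Matrix.mulVec_mulVec, Matrix.mul_nonsing_inv _ hB, Matrix.one_mulVec]

theorem inv_mulVec_mulVec {B : Matrix (Fin n) (Fin n) ℝ} (hB : IsUnit B.det) (v : Fin n → ℝ) :
    B⁻¹.mulVec (B.mulVec v) = v := by
  rw [Matrix.mulVec_mulVec, Matrix.nonsing_inv_mul _ hB, Matrix.one_mulVec]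

theorem IsExpanding.isSelfAffineSet_range_digitSum (hA : IsExpanding A)
    {D : Finset (Fin n → ℤ)} (hD : D.Nonempty) :
    IsSelfAffineSet A D (Set.range (digitSum A D)) where
  nonempty := by
    obtain ⟨d, hd⟩ := hD
    exact ⟨_, fun _ => ⟨d, hd⟩, rfl⟩
  isCompact := isCompact_range (hA.continuous_digitSum D)
  image_eq := by
    ext y
    simp only [Set.mem_image, Set.mem_range, Set.mem_iUnion]
    constructor
    · rintro ⟨_, ⟨d, rfl⟩, rfl⟩
      exact ⟨d 0, (d 0).2, _, ⟨_, rfl⟩, (hA.mulVec_digitSum d).symm⟩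
    · rintro ⟨e, he, _, ⟨d, rfl⟩, rfl⟩
      refine ⟨_, ⟨fun k => Nat.casesOn k ⟨e, he⟩ d, rfl⟩, ?_⟩
      exact hA.mulVec_digitSum _

theorem IsSelfAffineSet.mulVec_mem_iff {D : Finset (Fin n → ℤ)} {T : Set (Fin n → ℝ)}
    (hT : IsSelfAffineSet A D T) (hA : IsExpanding A) (x : Fin n → ℝ) :
    x ∈ T ↔ ∃ d ∈ D, (realMatrix A).mulVec x - (fun i => (d i : ℝ)) ∈ T := by
  have hinj : Function.Injective fun x => (realMatrix A).mulVec x :=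
    Function.LeftInverse.injective (inv_mulVec_mulVec hA.isUnit_det_realMatrix)
  rw [← hinj.mem_set_image, hT.image_eq]
  simp only [Set.mem_iUnion, Set.mem_image, exists_prop]
  refine exists_congr fun d => and_congr_right fun _ => ⟨?_, fun h => ⟨_, h, by simp⟩⟩
  rintro ⟨y, hy, hxy⟩
  rw [← hxy]
  simpa using hy

/-- One step of the address expansion of a point along a digit sequence. -/
theorem digitSum_eq_add (hA : IsExpanding A) {D : Finset (Fin n → ℤ)} (d : ℕ → D) :
    digitSum A D d = (realMatrix A)⁻¹.mulVec
      (digitSum A D (fun k => d (k + 1)) + fun i => ((d 0 : Fin n → ℤ) i : ℝ)) := by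
  rw [← hA.mulVec_digitSum, inv_mulVec_mulVec hA.isUnit_det_realMatrix]

/-- Each step multiplies the gap between the orbit point and the shifted digit sum by `A`. For a
bounded orbit the right side tends to `0`, so the orbit's digits represent its starting point. -/
theorem sub_digitSum_eq (hA : IsExpanding A) {D : Finset (Fin n → ℤ)} (d : ℕ → D)
    (x : ℕ → Fin n → ℝ) (hx : ∀ k, x (k + 1) =
      (realMatrix A).mulVec (x k) - fun i => ((d k : Fin n → ℤ) i : ℝ)) (m : ℕ) :
    x 0 - digitSum A D d =
      ((realMatrix A)⁻¹ ^ m).mulVec (x m - digitSum A D (fun k => d (k + m))) := by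
  induction m with
  | zero => simp
  | succ m ih =>
    have hstep : x m - digitSum A D (fun k => d (k + m)) = (realMatrix A)⁻¹.mulVec
        (x (m + 1) - digitSum A D (fun k => d (k + (m + 1)))) := by
      have h1 := digitSum_eq_add hA (fun k => d (k + m))
      simp only [zero_add] at h1
      rw [h1, hx m]
      nth_rewrite 1 [← inv_mulVec_mulVec hA.isUnit_det_realMatrix (x m)]
      rw [← Matrix.mulVec_sub]
      congr 1
      simp only [add_assoc, add_comm 1 m]
      abel
    rw [ih, hstep, Matrix.mulVec_mulVec, ← pow_succ]

theorem IsSelfAffineSet.eq_range_digitSum {D : Finset (Fin n → ℤ)} {T : Set (Fin n → ℝ)}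
    (hT : IsSelfAffineSet A D T) (hA : IsExpanding A) :
    T = Set.range (digitSum A D) := by
  obtain ⟨R, hR⟩ := hT.isCompact.isBounded.exists_norm_le
  obtain ⟨R', hR'⟩ := (isCompact_range (hA.continuous_digitSum D)).isBounded.exists_norm_le
  have hbd : ∀ (x : Fin n → ℝ) (d : ℕ → D), x ∈ T → ‖x - digitSum A D d‖ ≤ R + R' :=
    fun x d hx => (norm_sub_le _ _).trans (add_le_add (hR _ hx) (hR' _ ⟨d, rfl⟩))
  apply Set.Subset.antisymm
  · intro x hx
    choose e he using fun y : T => (hT.mulVec_mem_iff hA y.1).1 y.2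
    let nxt : T → T := fun y => ⟨_, (he y).2⟩
    let s : ℕ → T := fun k => nxt^[k] ⟨x, hx⟩
    have hs : ∀ k, s (k + 1) = nxt (s k) := fun k => Function.iterate_succ_apply' _ _ _
    let d : ℕ → D := fun k => ⟨e (s k), (he (s k)).1⟩
    have key := sub_digitSum_eq hA d (fun k => (s k : Fin n → ℝ)) (fun k => by rw [hs])
    have hlim := hA.tendsto_inv_pow_mulVec (u := fun m => (s m : Fin n → ℝ) -
      digitSum A D (fun k => d (k + m))) (R := R + R') (fun m => hbd _ _ (s m).2)
    have : x - digitSum A D d = 0 := by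
      refine tendsto_nhds_unique ?_ hlim
      simp only [← key]
      exact tendsto_const_nhds
    exact ⟨d, (sub_eq_zero.1 this).symm⟩
  · rintro _ ⟨d, rfl⟩
    obtain ⟨t, ht⟩ := hT.nonempty
    -- These points keep the first `m` digits and replace the tail by `t`; they converge to the
    -- digit sum, and `T` is closed.
    have hy : ∀ m (d : ℕ → D), digitSum A D d +
        ((realMatrix A)⁻¹ ^ m).mulVec (t - digitSum A D (fun k => d (k + m))) ∈ T := by
      intro m
      induction m with
      | zero => intro d; simpa using ht
      | succ m ih =>
        intro d
        rw [hT.mulVec_mem_iff hA]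
        refine ⟨d 0, (d 0).2, ?_⟩
        rw [Matrix.mulVec_add, hA.mulVec_digitSum, Matrix.mulVec_mulVec, pow_succ', ← mul_assoc,
          Matrix.mul_nonsing_inv _ hA.isUnit_det_realMatrix, one_mul]
        convert ih (fun k => d (k + 1)) using 1
        simp only [add_assoc]
        abel
    have hlim := (hA.tendsto_inv_pow_mulVec (u := fun m => t -
      digitSum A D (fun k => d (k + m))) (R := R + R') (fun m => hbd _ _ ht)).const_add
        (digitSum A D d)
    rw [add_zero] at hlim
    exact hT.isCompact.isClosed.mem_of_tendsto hlim (Filter.Eventually.of_forall fun m => hy m d)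

theorem IsExpanding.existsUnique_isSelfAffineSet (hA : IsExpanding A)
    {D : Finset (Fin n → ℤ)} (hD : D.Nonempty) :
    ∃! T : Set (Fin n → ℝ), IsSelfAffineSet A D T :=
  ⟨_, hA.isSelfAffineSet_range_digitSum hD, fun _ hT => hT.eq_range_digitSum hA⟩

end Expanding

/-! ### Passage between `ℝⁿ` and the torus -/

section Torus

variable {n : ℕ}

/-- An integer vector, as a real vector. -/
def intVec (z : Fin n → ℤ) : Fin n → ℝ := fun i => (z i : ℝ)

/-- The projection of `ℝⁿ` onto the torus. -/
def toTorus (x : Fin n → ℝ) : UnitAddTorus (Fin n) := fun i => (x i : UnitAddCircle)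

/-- The half-open unit cube. -/
def unitCube (n : ℕ) : Set (Fin n → ℝ) := Set.univ.pi fun _ => Set.Ioc 0 (0 + 1)

theorem measurableSet_unitCube : MeasurableSet (unitCube n) :=
  MeasurableSet.univ_pi fun _ => measurableSet_Ioc

theorem measurePreserving_toTorus :
    MeasurePreserving (toTorus (n := n)) (volume.restrict (unitCube n)) volume := by
  have h := measurePreserving_pi (ι := Fin n) (fun _ => volume.restrict (Set.Ioc (0 : ℝ) (0 + 1)))
    (fun _ => (volume : Measure UnitAddCircle)) (fun _ => AddCircle.measurePreserving_mk 1 0)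
  rw [← Measure.restrict_pi_pi] at h
  exact h

theorem volume_unitCube : volume (unitCube n) = 1 := by
  simp [unitCube, volume_pi]

theorem existsUnique_add_intVec_mem_unitCube (x : Fin n → ℝ) :
    ∃! z : Fin n → ℤ, x + intVec z ∈ unitCube n := by
  have h : ∀ i, ∃! m : ℤ, x i + m ∈ Set.Ioc (0 : ℝ) (0 + 1) := fun i => by
    simpa using existsUnique_add_zsmul_mem_Ioc (zero_lt_one' ℝ) (x i) 0
  choose z hz hz' using h
  refine ⟨z, fun i _ => hz i, fun w hw => funext fun i => hz' i _ (hw i trivial)⟩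

theorem toTorus_add_intVec (x : Fin n → ℝ) (z : Fin n → ℤ) :
    toTorus (x + intVec z) = toTorus x := by
  funext i
  simp [toTorus, intVec]

theorem exists_eq_add_intVec_of_toTorus_eq {x y : Fin n → ℝ} (h : toTorus x = toTorus y) :
    ∃ z, x = y + intVec z := by
  have h' : ∀ i, ∃ m : ℤ, x i = y i + m := fun i => by
    have h1 : ((x i - y i : ℝ) : UnitAddCircle) = 0 := by
      have := congrFun h i
      simp only [toTorus] at this
      rw [AddCircle.coe_sub, this, sub_self]
    obtain ⟨m, hm⟩ := (AddCircle.coe_eq_zero_iff 1).1 h1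
    refine ⟨m, ?_⟩
    simp at hm
    linarith
  choose z hz using h'
  exact ⟨z, funext hz⟩

theorem continuous_toTorus : Continuous (toTorus (n := n)) :=
  continuous_pi fun i => (AddCircle.continuous_mk' 1).comp (continuous_apply i)

theorem surjective_toTorus : Function.Surjective (toTorus (n := n)) := fun t => by
  choose x hx using fun i => QuotientAddGroup.mk_surjective (t i)
  exact ⟨x, funext hx⟩

/-- The endomorphism of the torus induced by an integer matrix. -/
noncomputable def torusEnd (A : Matrix (Fin n) (Fin n) ℤ) :
    UnitAddTorus (Fin n) →+ UnitAddTorus (Fin n) where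
  toFun t i := ∑ j, A i j • t j
  map_zero' := by ext; simp
  map_add' s t := by ext; simp [Finset.sum_add_distrib]

theorem torusEnd_toTorus (A : Matrix (Fin n) (Fin n) ℤ) (x : Fin n → ℝ) :
    torusEnd A (toTorus x) = toTorus ((realMatrix A).mulVec x) := by
  funext i
  have : ∀ s : Finset (Fin n), ((∑ j ∈ s, (A i j : ℝ) * x j : ℝ) : UnitAddCircle) =
      ∑ j ∈ s, A i j • ((x j : ℝ) : UnitAddCircle) := fun s => by
    induction s using Finset.induction_on with
    | empty => simp
    | insert a s ha ih =>
      rw [Finset.sum_insert ha, Finset.sum_insert ha, AddCircle.coe_add, ih,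
        ← AddCircle.coe_zsmul, zsmul_eq_mul]
  simp [torusEnd, toTorus, Matrix.mulVec, dotProduct, this]

theorem continuous_torusEnd (A : Matrix (Fin n) (Fin n) ℤ) : Continuous (torusEnd A) := by
  refine continuous_pi fun i => ?_
  have h : ∀ j, Continuous fun t : UnitAddTorus (Fin n) => A i j • t j := fun j =>
    (continuous_zsmul (A i j)).comp (continuous_apply j)
  change Continuous fun t : UnitAddTorus (Fin n) => ∑ j, A i j • t j
  exact continuous_finsetSum Finset.univ fun j _ => h j

/-! ### Ergodicity of the toral endomorphism -/

variable {A : Matrix (Fin n) (Fin n) ℤ}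

theorem IsExpanding.measurePreserving_torusEnd (hA : IsExpanding A) :
    MeasurePreserving (torusEnd A) volume volume := by
  refine AddMonoidHom.measurePreserving (continuous_torusEnd A) (fun t => ?_) rfl
  obtain ⟨x, rfl⟩ := surjective_toTorus t
  exact ⟨toTorus ((realMatrix A)⁻¹.mulVec x), by
    rw [torusEnd_toTorus, mulVec_inv_mulVec hA.isUnit_det_realMatrix]⟩

theorem iterate_torusEnd_toTorus (k : ℕ) (x : Fin n → ℝ) :
    (torusEnd A)^[k] (toTorus x) = toTorus ((realMatrix A ^ k).mulVec x) := by
  induction k with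
  | zero => simp
  | succ k ih =>
    rw [Function.iterate_succ_apply', ih, torusEnd_toTorus, Matrix.mulVec_mulVec, pow_succ']

/-- Subtracting from `x` the image under `A⁻ᵏ` of the fractional part of `Aᵏ x` gives a point that
`Aᵏ` sends to the lattice, and the correction tends to `0`. -/
theorem IsExpanding.dense_iterate_torusEnd_eq_zero (hA : IsExpanding A) :
    Dense {g : UnitAddTorus (Fin n) | ∃ k, (torusEnd A)^[k] g = 0} := by
  intro t
  obtain ⟨x, rfl⟩ := surjective_toTorus t
  let u : ℕ → Fin n → ℝ := fun k i => Int.fract (((realMatrix A ^ k).mulVec x) i)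
  have hu : ∀ k, ‖u k‖ ≤ 1 := fun k => by
    refine (pi_norm_le_iff_of_nonneg zero_le_one).2 fun i => ?_
    rw [Real.norm_of_nonneg (Int.fract_nonneg _)]
    exact (Int.fract_lt_one _).le
  have hlim := (hA.tendsto_inv_pow_mulVec hu).const_sub x
  rw [sub_zero] at hlim
  refine mem_closure_of_tendsto ((continuous_toTorus.tendsto x).comp hlim)
    (Filter.Eventually.of_forall fun k => ⟨k, ?_⟩)
  have hinv : realMatrix A ^ k * (realMatrix A)⁻¹ ^ k = 1 := by
    rw [Matrix.inv_pow', Matrix.mul_nonsing_inv]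
    rw [Matrix.det_pow]
    exact hA.isUnit_det_realMatrix.pow k
  simp only [Function.comp_apply]
  rw [iterate_torusEnd_toTorus, Matrix.mulVec_sub, Matrix.mulVec_mulVec, hinv, Matrix.one_mulVec]
  have : (realMatrix A ^ k).mulVec x - u k =
      0 + intVec fun i => ⌊((realMatrix A ^ k).mulVec x) i⌋ := by
    funext i
    simp [u, intVec, -Int.self_sub_floor]
  rw [this, toTorus_add_intVec]
  funext i
  simp [toTorus]

theorem eventuallyConst_of_dense_preimage_add_ae {G : Type*} [AddCommGroup G] [TopologicalSpace G]
    [IsTopologicalAddGroup G] [R1Space G] [SecondCountableTopology G] [MeasurableSpace G]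
    [BorelSpace G] {μ : Measure G} [IsFiniteMeasure μ] [μ.InnerRegular] [μ.IsAddLeftInvariant]
    {s : Set G} (hs : NullMeasurableSet s μ) (hd : Dense {g : G | (g + ·) ⁻¹' s =ᵐ[μ] s}) :
    Filter.EventuallyConst s (ae μ) :=
  aeconst_of_dense_setOfPred_preimage_vadd_ae (M := G) hs hd

/-- The preimage of `E` lies in `E` and has the same finite measure, so `E` is invariant up to null
sets. It is therefore almost invariant under translation by every point that some iterate kills, and
these are dense. -/
theorem IsExpanding.eventuallyConst_torus (hA : IsExpanding A) {E : Set (UnitAddTorus (Fin n))}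
    (hE : MeasurableSet E) (h : ∀ᵐ t, torusEnd A t ∈ E → t ∈ E) :
    Filter.EventuallyConst E (ae (volume : Measure (UnitAddTorus (Fin n)))) := by
  have hmp := hA.measurePreserving_torusEnd
  have heq : torusEnd A ⁻¹' E =ᵐ[volume] E :=
    ae_eq_of_ae_subset_of_measure_ge h (hmp.measure_preimage hE.nullMeasurableSet).ge
      (hmp.measurable hE).nullMeasurableSet (measure_ne_top _ _)
  refine eventuallyConst_of_dense_preimage_add_ae
    hE.nullMeasurableSet (hA.dense_iterate_torusEnd_eq_zero.mono ?_)
  rintro g ⟨k, hk⟩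
  have hk' := hmp.quasiMeasurePreserving.preimage_iterate_ae_eq k heq
  have h1 : (g + ·) ⁻¹' ((torusEnd A)^[k] ⁻¹' E) = (torusEnd A)^[k] ⁻¹' E := by
    ext t
    simp only [Set.mem_preimage]
    rw [iterate_map_add, hk, zero_add]
  have h2 := (measurePreserving_add_left
    (volume : Measure (UnitAddTorus (Fin n))) g).quasiMeasurePreserving.preimage_ae_eq hk'
  rw [h1] at h2
  exact h2.symm.trans hk'

theorem volume_eq_zero_of_inter_unitCube {E : Set (Fin n → ℝ)}
    (hE : ∀ x z, x + intVec z ∈ E ↔ x ∈ E) (h : volume (E ∩ unitCube n) = 0) : volume E = 0 := by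
  have hsub : E ⊆ ⋃ z : Fin n → ℤ, (fun x => x + intVec z) ⁻¹' (E ∩ unitCube n) := fun x hx => by
    obtain ⟨z, hz, -⟩ := existsUnique_add_intVec_mem_unitCube x
    exact Set.mem_iUnion.2 ⟨z, (hE x z).2 hx, hz⟩
  refine measure_mono_null hsub (measure_iUnion_null fun z => ?_)
  rw [measure_preimage_add_right, h]

/-- A periodic set which contains its preimage under an expanding integer matrix is null or
conull. -/
theorem IsExpanding.volume_eq_zero_or_compl (hA : IsExpanding A) {E : Set (Fin n → ℝ)}
    (hmeas : MeasurableSet E) (hper : ∀ x z, x + intVec z ∈ E ↔ x ∈ E)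
    (h : ∀ᵐ x, (realMatrix A).mulVec x ∈ E → x ∈ E) : volume E = 0 ∨ volume Eᶜ = 0 := by
  -- A measurable choice of representatives: periodicity makes `lift ⁻¹' E` pull back to exactly
  -- `E`, with no image to measure.
  let lift : UnitAddTorus (Fin n) → Fin n → ℝ := fun t i => (AddCircle.equivIoc 1 0 (t i) : ℝ)
  have hlift : Measurable lift := measurable_pi_lambda _ fun i =>
    measurable_subtype_coe.comp
      ((AddCircle.measurableEquivIoc 1 0).measurable.comp (measurable_pi_apply i))
  have hlift' : ∀ t, toTorus (lift t) = t := fun t => funext fun i =>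
    (AddCircle.equivIoc 1 0).symm_apply_apply (t i)
  have hmem : ∀ x, toTorus x ∈ lift ⁻¹' E ↔ x ∈ E := fun x => by
    obtain ⟨z, hz⟩ := exists_eq_add_intVec_of_toTorus_eq (hlift' (toTorus x))
    rw [Set.mem_preimage, hz, hper]
  have hmE : MeasurableSet (lift ⁻¹' E) := hlift hmeas
  have hnull : ∀ F : Set (UnitAddTorus (Fin n)), MeasurableSet F → volume F = 0 →
      volume (toTorus ⁻¹' F) = 0 := fun F hF h0 => by
    refine volume_eq_zero_of_inter_unitCube (fun x z => ?_) ?_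
    · rw [Set.mem_preimage, toTorus_add_intVec, Set.mem_preimage]
    · rw [← Measure.restrict_apply (continuous_toTorus.measurable hF),
        measurePreserving_toTorus.measure_preimage hF.nullMeasurableSet, h0]
  have hae : ∀ᵐ t, torusEnd A t ∈ lift ⁻¹' E → t ∈ lift ⁻¹' E := by
    have hset : MeasurableSet {t | torusEnd A t ∈ lift ⁻¹' E → t ∈ lift ⁻¹' E} :=
      MeasurableSet.imp ((continuous_torusEnd A).measurable hmE) hmE
    rw [← measurePreserving_toTorus.map_eq,
      ae_map_iff continuous_toTorus.measurable.aemeasurable hset]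
    refine ae_restrict_of_ae (h.mono fun x hx => ?_)
    rwa [torusEnd_toTorus, hmem, hmem]
  have hpre : toTorus ⁻¹' (lift ⁻¹' E) = E := Set.ext hmem
  rcases Filter.eventuallyConst_set.1 (hA.eventuallyConst_torus hmE hae) with h1 | h1
  · right
    rw [← hpre, ← Set.preimage_compl]
    exact hnull _ hmE.compl h1
  · left
    rw [← hpre]
    refine hnull _ hmE ?_
    have h2 : ∀ᵐ t, t ∉ lift ⁻¹' E := h1
    rw [ae_iff] at h2
    simp only [not_not] at h2
    exact h2

/-- Unfolding an integral over `ℝⁿ` along the lattice `ℤⁿ`. -/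
theorem lintegral_eq_tsum_unitCube (g : (Fin n → ℝ) → ENNReal) :
    ∫⁻ x, g x = ∑' z : Fin n → ℤ, ∫⁻ x in unitCube n, g (x - intVec z) := by
  have hU : (⋃ z : Fin n → ℤ, (fun x => x + intVec z) ⁻¹' unitCube n) = Set.univ := by
    refine Set.eq_univ_of_forall fun x => ?_
    obtain ⟨z, hz, -⟩ := existsUnique_add_intVec_mem_unitCube x
    exact Set.mem_iUnion.2 ⟨z, hz⟩
  rw [← setLIntegral_univ, ← hU, lintegral_iUnion]
  · refine tsum_congr fun z => ?_
    have := (measurePreserving_add_right volume (intVec z)).setLIntegral_comp_preimage_emb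
      (MeasurableEquiv.addRight (intVec z)).measurableEmbedding
      (fun x => g (x - intVec z)) (unitCube n)
    simpa using this
  · exact fun z => measurableSet_unitCube.preimage (measurable_add_const _)
  · intro z w hzw
    refine Set.disjoint_left.2 fun x hx hy => hzw ?_
    exact (existsUnique_add_intVec_mem_unitCube x).unique hx hy

end Torus

/-! ### Lattice patterns and their volumes -/

section Pattern

variable {n : ℕ}

theorem finite_setOf_norm_intVec_le (R : ℝ) : {z : Fin n → ℤ | ‖intVec z‖ ≤ R}.Finite := by
  refine (Set.finite_Icc (fun _ => -⌈R⌉) (fun _ => ⌈R⌉)).subset fun z hz => ?_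
  have h : ∀ i, |z i| ≤ ⌈R⌉ := fun i => by
    have h1 : ‖intVec z i‖ ≤ R := (norm_le_pi_norm (intVec z) i).trans hz
    rw [intVec, Real.norm_eq_abs] at h1
    exact_mod_cast h1.trans (Int.le_ceil R)
  exact ⟨fun i => (abs_le.1 (h i)).1, fun i => (abs_le.1 (h i)).2⟩

theorem intVec_zero : intVec (0 : Fin n → ℤ) = 0 := by
  ext; simp [intVec]

theorem intVec_sub (z w : Fin n → ℤ) : intVec (z - w) = intVec z - intVec w := by
  ext; simp [intVec]

theorem intVec_add (z w : Fin n → ℤ) : intVec (z + w) = intVec z + intVec w := by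
  ext; simp [intVec]

theorem intVec_neg (z : Fin n → ℤ) : intVec (-z) = -intVec z := by
  ext; simp [intVec]

theorem realMatrix_mulVec_intVec (A : Matrix (Fin n) (Fin n) ℤ) (z : Fin n → ℤ) :
    (realMatrix A).mulVec (intVec z) = intVec (A.mulVec z) := by
  ext i; simp [intVec, Matrix.mulVec, dotProduct]

open Classical in
/-- The set of integer vectors `z` with `x + z ∈ T` (if this set is finite). -/
noncomputable def latticePattern (T : Set (Fin n → ℝ)) (x : Fin n → ℝ) : Finset (Fin n → ℤ) :=
  if h : {z | x + intVec z ∈ T}.Finite then h.toFinset else ∅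

variable {T : Set (Fin n → ℝ)}

theorem mem_latticePattern (hT : IsCompact T) {x : Fin n → ℝ} {z : Fin n → ℤ} :
    z ∈ latticePattern T x ↔ x + intVec z ∈ T := by
  obtain ⟨R, hR⟩ := hT.isBounded.exists_norm_le
  have h : {z | x + intVec z ∈ T}.Finite := by
    refine (finite_setOf_norm_intVec_le (R + ‖x‖)).subset fun z hz => ?_
    have := norm_sub_le (x + intVec z) x
    rw [add_sub_cancel_left] at this
    exact this.trans (by gcongr; exact hR _ hz)
  simp [latticePattern, h]

/-- The window does not depend on `x`, so up to translation only finitely many nonempty patterns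
occur. -/
theorem exists_window (hT : IsCompact T) : ∃ B : Finset (Fin n → ℤ), ∀ x z w,
    z ∈ latticePattern T x → w ∈ latticePattern T x → w - z ∈ B := by
  obtain ⟨R, hR⟩ := hT.isBounded.exists_norm_le
  refine ⟨(finite_setOf_norm_intVec_le (R + R)).toFinset, fun x z w hz hw => ?_⟩
  rw [mem_latticePattern hT] at hz hw
  rw [Set.Finite.mem_toFinset, Set.mem_ofPred_eq]
  have : intVec (w - z) = (x + intVec w) - (x + intVec z) := by rw [intVec_sub]; abel
  rw [this]
  exact (norm_sub_le _ _).trans (add_le_add (hR _ hw) (hR _ hz))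

theorem latticePattern_add_intVec (hT : IsCompact T) (x : Fin n → ℝ) (w : Fin n → ℤ) :
    latticePattern T (x + intVec w) = (latticePattern T x).image (· - w) := by
  ext z
  rw [mem_latticePattern hT, add_assoc, ← intVec_add, ← mem_latticePattern hT]
  simp [sub_eq_iff_eq_add, add_comm]

theorem measurableSet_latticePattern_eq (hT : IsCompact T) (p : Finset (Fin n → ℤ)) :
    MeasurableSet {x | latticePattern T x = p} := by
  have h : {x | latticePattern T x = p} = ⋂ z, {x | x + intVec z ∈ T ↔ z ∈ p} := by
    ext x
    simp only [Set.mem_ofPred_eq, Finset.ext_iff, mem_latticePattern hT, Set.mem_iInter]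
  rw [h]
  exact MeasurableSet.iInter fun z => MeasurableSet.iff
    (hT.measurableSet.preimage (measurable_add_const (intVec z))) (MeasurableSet.const _)

theorem measurableSet_preimage_latticePattern (hT : IsCompact T)
    (C : Set (Finset (Fin n → ℤ))) : MeasurableSet {x | latticePattern T x ∈ C} := by
  have h : {x | latticePattern T x ∈ C} = ⋃ p ∈ C, {x | latticePattern T x = p} := by
    ext x; simp
  rw [h]
  exact MeasurableSet.biUnion C.to_countable fun p _ => measurableSet_latticePattern_eq hT p

/-- The volume of the set of points with a given lattice pattern. -/
noncomputable def patternVolume (T : Set (Fin n → ℝ)) (p : Finset (Fin n → ℤ)) : ENNReal :=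
  volume {x | latticePattern T x = p}

theorem patternVolume_ne_top (hT : IsCompact T) {p : Finset (Fin n → ℤ)} (hp : p.Nonempty) :
    patternVolume T p ≠ ⊤ := by
  obtain ⟨z, hz⟩ := hp
  have h : {x | latticePattern T x = p} ⊆ (fun x => x + intVec z) ⁻¹' T := by
    rintro x rfl
    exact (mem_latticePattern hT).1 hz
  refine ne_top_of_le_ne_top ?_ (measure_mono h)
  rw [measure_preimage_add_right]
  exact hT.measure_lt_top.ne

theorem exists_latticePattern_eq {p : Finset (Fin n → ℤ)} (hp : patternVolume T p ≠ 0) :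
    ∃ x, latticePattern T x = p :=
  nonempty_of_measure_ne_zero hp

theorem patternVolume_image_sub (hT : IsCompact T) (p : Finset (Fin n → ℤ)) (w : Fin n → ℤ) :
    patternVolume T (p.image (· - w)) = patternVolume T p := by
  have h : {x | latticePattern T x = p.image (· - w)} =
      (fun x => x + intVec (-w)) ⁻¹' {x | latticePattern T x = p} := by
    ext x
    simp only [Set.mem_ofPred_eq, Set.mem_preimage]
    rw [latticePattern_add_intVec hT]
    constructor
    · intro h
      rw [h, Finset.image_image]
      simp [Function.comp_def]
    · rintro rfl
      rw [Finset.image_image]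
      simp [Function.comp_def]
  rw [patternVolume, h, measure_preimage_add_right, patternVolume]

theorem latticePattern_mem_of_zero_mem {B : Finset (Fin n → ℤ)}
    (hB : ∀ x z w, z ∈ latticePattern T x → w ∈ latticePattern T x → w - z ∈ B)
    {x : Fin n → ℝ} (hx : 0 ∈ latticePattern T x) :
    latticePattern T x ∈ B.powerset.filter (0 ∈ ·) := by
  rw [Finset.mem_filter, Finset.mem_powerset]
  exact ⟨fun w hw => by simpa using hB x 0 w hx hw, hx⟩

theorem volume_eq_sum_patternVolume (hT : IsCompact T) {B : Finset (Fin n → ℤ)}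
    (hB : ∀ x z w, z ∈ latticePattern T x → w ∈ latticePattern T x → w - z ∈ B) :
    volume T = ∑ p ∈ B.powerset.filter (0 ∈ ·), patternVolume T p := by
  have h0 : ∀ x, x ∈ T ↔ 0 ∈ latticePattern T x := fun x => by
    rw [mem_latticePattern hT, intVec_zero, add_zero]
  have h : T = ⋃ p ∈ B.powerset.filter (0 ∈ ·), {x | latticePattern T x = p} := by
    ext x
    simp only [Set.mem_iUnion, Set.mem_ofPred_eq, exists_prop, exists_eq_right']
    rw [h0]
    exact ⟨latticePattern_mem_of_zero_mem hB, fun h => (Finset.mem_filter.1 h).2⟩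
  conv_lhs => rw [h]
  rw [measure_biUnion_finset]
  · rfl
  · intro p _ q _ hpq
    exact Set.disjoint_left.2 fun x hx hy => hpq (hx.symm.trans hy)
  · exact fun p _ => measurableSet_latticePattern_eq hT p

/-- The sum is the integral over `T` of the reciprocal of the pattern's size. Unfolded along `ℤⁿ`,
almost every point of the unit cube has as many translates in `T` as its pattern has elements, each
of that weight, so the integrand is `1`. -/
theorem sum_patternVolume_div_card (hT : IsCompact T) {B : Finset (Fin n → ℤ)}
    (hB : ∀ x z w, z ∈ latticePattern T x → w ∈ latticePattern T x → w - z ∈ B)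
    (hne : ∀ᵐ x, (latticePattern T x).Nonempty) :
    ∑ p ∈ B.powerset.filter (0 ∈ ·), (p.card : ENNReal)⁻¹ * patternVolume T p = 1 := by
  let g : (Fin n → ℝ) → ENNReal := fun x => ∑ p ∈ B.powerset.filter (0 ∈ ·),
    Set.indicator {x | latticePattern T x = p} (fun _ => (p.card : ENNReal)⁻¹) x
  have hgm : Measurable g := Finset.measurable_fun_sum _ fun p _ =>
    measurable_const.indicator (measurableSet_latticePattern_eq hT p)
  have hg : ∀ x, g x = if 0 ∈ latticePattern T x then
      ((latticePattern T x).card : ENNReal)⁻¹ else 0 := fun x => by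
    have h1 : g x = ∑ p ∈ B.powerset.filter (0 ∈ ·),
        if latticePattern T x = p then (p.card : ENNReal)⁻¹ else 0 := by
      simp only [g, Set.indicator_apply, Set.mem_ofPred_eq]
    rw [h1, Finset.sum_ite_eq]
    refine if_congr ⟨fun h => (Finset.mem_filter.1 h).2, latticePattern_mem_of_zero_mem hB⟩ rfl rfl
  have hint : ∫⁻ x, g x = ∑ p ∈ B.powerset.filter (0 ∈ ·),
      (p.card : ENNReal)⁻¹ * patternVolume T p := by
    rw [lintegral_finsetSum]
    · refine Finset.sum_congr rfl fun p _ => ?_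
      rw [lintegral_indicator_const (measurableSet_latticePattern_eq hT p), patternVolume]
    · exact fun p _ => measurable_const.indicator (measurableSet_latticePattern_eq hT p)
  rw [← hint, lintegral_eq_tsum_unitCube, ← lintegral_tsum]
  · have hone : ∀ᵐ x, ∑' z : Fin n → ℤ, g (x - intVec z) = 1 := by
      filter_upwards [hne] with x hx
      have hterm : ∀ z : Fin n → ℤ, g (x - intVec z) = if z ∈ (latticePattern T x).image (- ·) then
          ((latticePattern T x).card : ENNReal)⁻¹ else 0 := fun z => by
        rw [hg, sub_eq_add_neg, ← intVec_neg, latticePattern_add_intVec hT,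
          Finset.card_image_of_injective _ (sub_left_injective)]
        refine if_congr ?_ rfl rfl
        simp only [Finset.mem_image]
        refine exists_congr fun w => and_congr_right fun _ => ?_
        rw [sub_neg_eq_add, neg_eq_iff_add_eq_zero]
      rw [tsum_congr hterm, tsum_eq_sum (s := (latticePattern T x).image (- ·))
        (fun z hz => if_neg hz), Finset.sum_congr rfl (fun z hz => if_pos hz), Finset.sum_const,
        Finset.card_image_of_injective _ neg_injective, nsmul_eq_mul]
      exact ENNReal.mul_inv_cancel (by simpa using hx.ne_empty) (ENNReal.natCast_ne_top _)
    rw [lintegral_congr_ae (ae_restrict_of_ae hone)]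
    simp [volume_unitCube]
  · exact fun z => (hgm.comp (measurable_sub_const _)).aemeasurable

/-! ### The linear system for pattern volumes and rationality -/

variable {A : Matrix (Fin n) (Fin n) ℤ} {D : Finset (Fin n → ℤ)}

/-- `q` is the pattern at `x` if `p` is the pattern at `A x`. -/
def IsPatternStep (A : Matrix (Fin n) (Fin n) ℤ) (D p q : Finset (Fin n → ℤ)) : Prop :=
  ∀ z, z ∈ q ↔ ∃ d ∈ D, A.mulVec z - d ∈ p

theorem IsSelfAffineSet.isPatternStep (hT : IsSelfAffineSet A D T) (hA : IsExpanding A)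
    (x : Fin n → ℝ) :
    IsPatternStep A D (latticePattern T ((realMatrix A).mulVec x)) (latticePattern T x) := by
  intro z
  rw [mem_latticePattern hT.isCompact, hT.mulVec_mem_iff hA]
  refine exists_congr fun d => and_congr_right fun _ => ?_
  rw [mem_latticePattern hT.isCompact, Matrix.mulVec_add, realMatrix_mulVec_intVec, intVec_sub,
    add_sub_assoc]
  rfl

theorem IsSelfAffineSet.latticePattern_eq_iff (hT : IsSelfAffineSet A D T) (hA : IsExpanding A)
    (x : Fin n → ℝ) (q : Finset (Fin n → ℤ)) :
    latticePattern T x = q ↔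
      IsPatternStep A D (latticePattern T ((realMatrix A).mulVec x)) q := by
  constructor
  · rintro rfl
    exact hT.isPatternStep hA x
  · intro h
    ext z
    rw [h z, hT.isPatternStep hA x z]

theorem IsPatternStep.nonempty {p q : Finset (Fin n → ℤ)} (h : IsPatternStep A D p q)
    (hq : q.Nonempty) : p.Nonempty := by
  obtain ⟨z, hz⟩ := hq
  obtain ⟨d, -, hd⟩ := (h z).1 hz
  exact ⟨_, hd⟩

theorem IsSelfAffineSet.exists_patternVolume_eq_sum (hT : IsSelfAffineSet A D T)
    (hA : IsExpanding A) {q : Finset (Fin n → ℤ)} (hq : q.Nonempty) :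
    ∃ F : Finset (Finset (Fin n → ℤ)), (∀ p ∈ F, p.Nonempty) ∧
      (∀ x, IsPatternStep A D (latticePattern T x) q → latticePattern T x ∈ F) ∧
      ((|A.det| : ℤ) : ℝ) * (patternVolume T q).toReal = ∑ p ∈ F, (patternVolume T p).toReal := by
  classical
  obtain ⟨B, hB⟩ := exists_window hT.isCompact
  obtain ⟨z, hz⟩ := hq
  -- Fixing one `z ∈ q`, a predecessor that occurs contains some `A z - d`, so it lies in a
  -- translate of the window. This makes the sum finite.
  let F : Finset (Finset (Fin n → ℤ)) := (D.biUnion fun d =>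
    (B.image (· + (A.mulVec z - d))).powerset).filter fun p => IsPatternStep A D p q
  have hF : ∀ p ∈ F, IsPatternStep A D p q := fun p hp => (Finset.mem_filter.1 hp).2
  have hF' : ∀ x, IsPatternStep A D (latticePattern T x) q → latticePattern T x ∈ F := by
    intro x hx
    obtain ⟨d, hd, hp⟩ := (hx z).1 hz
    refine Finset.mem_filter.2 ⟨Finset.mem_biUnion.2 ⟨d, hd, Finset.mem_powerset.2 fun w hw => ?_⟩,
      hx⟩
    exact Finset.mem_image.2 ⟨_, hB x _ w hp hw, by simp⟩
  have hFne : ∀ p ∈ F, p.Nonempty := fun p hp => (hF p hp).nonempty ⟨z, hz⟩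
  refine ⟨F, hFne, hF', ?_⟩
  have hU : {y | IsPatternStep A D (latticePattern T y) q} =
      ⋃ p ∈ F, {y | latticePattern T y = p} := by
    ext y
    simp only [Set.mem_iUnion, Set.mem_ofPred_eq, exists_prop, exists_eq_right']
    exact ⟨hF' y, hF _⟩
  have hsum : volume {y | IsPatternStep A D (latticePattern T y) q} =
      ∑ p ∈ F, patternVolume T p := by
    rw [hU, measure_biUnion_finset]
    · rfl
    · intro p _ q _ hpq
      exact Set.disjoint_left.2 fun x hx hy => hpq (hx.symm.trans hy)
    · exact fun p _ => measurableSet_latticePattern_eq hT.isCompact p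
  have hpre : {x | latticePattern T x = q} = Matrix.toLin' (realMatrix A) ⁻¹'
      {y | IsPatternStep A D (latticePattern T y) q} := by
    ext x
    exact hT.latticePattern_eq_iff hA x q
  have hdet : (A.det : ℝ) ≠ 0 := by exact_mod_cast hA.det_ne_zero
  have hdet' : LinearMap.det (Matrix.toLin' (realMatrix A)) = A.det := by
    rw [LinearMap.det_toLin', det_realMatrix]
  have hvol : patternVolume T q = ENNReal.ofReal |(A.det : ℝ)⁻¹| * ∑ p ∈ F, patternVolume T p := by
    rw [← hsum, patternVolume, hpre, Measure.addHaar_preimage_linearMap _ (by rwa [hdet']), hdet']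
  rw [hvol, ENNReal.toReal_mul, ENNReal.toReal_ofReal (abs_nonneg _),
    ENNReal.toReal_sum fun p hp => patternVolume_ne_top hT.isCompact (hFne p hp), ← mul_assoc,
    abs_inv, Int.cast_abs, mul_inv_cancel₀ (abs_ne_zero.2 hdet), one_mul]

/-- Emptiness passes from `A x` to `x`, so by ergodicity the empty pattern has null or conull locus;
conull would make `T` null. -/
theorem IsSelfAffineSet.ae_latticePattern_nonempty (hT : IsSelfAffineSet A D T)
    (hA : IsExpanding A) (h0 : volume T ≠ 0) : ∀ᵐ x, (latticePattern T x).Nonempty := by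
  have h := hA.volume_eq_zero_or_compl (E := {x | latticePattern T x = ∅})
    (measurableSet_latticePattern_eq hT.isCompact ∅)
    (fun x z => by simp [latticePattern_add_intVec hT.isCompact])
    (Filter.Eventually.of_forall fun x hx => by
      rw [Set.mem_ofPred_eq] at hx ⊢
      by_contra hne
      exact (((hT.isPatternStep hA x).nonempty (Finset.nonempty_iff_ne_empty.2 hne)).ne_empty) hx)
  rcases h with h | h
  · rw [ae_iff]
    simpa only [Finset.not_nonempty_iff_eq_empty] using h
  · refine absurd (measure_mono_null (fun x hx => ?_) h) h0
    have : 0 ∈ latticePattern T x := by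
      rwa [mem_latticePattern hT.isCompact, intVec_zero, add_zero]
    exact Finset.ne_empty_of_mem this

/-- Rational-linear functionals act on the pattern volumes as scalars. -/
theorem IsSelfAffineSet.exists_forall_linearMap_patternVolume (hT : IsSelfAffineSet A D T)
    (hA : IsExpanding A) (h0 : volume T ≠ 0) (L : ℝ →ₗ[ℚ] ℝ) :
    ∃ t : ℝ, ∀ p : Finset (Fin n → ℤ), p.Nonempty →
      L (patternVolume T p).toReal = t * (patternVolume T p).toReal := by
  obtain ⟨B, hB⟩ := exists_window hT.isCompact
  let a : Finset (Fin n → ℤ) → ℝ := fun p => (patternVolume T p).toReal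
  let S := (B.powerset.filter (0 ∈ ·)).filter fun p => patternVolume T p ≠ 0
  have hS : S.Nonempty := by
    by_contra hS
    refine h0 ?_
    rw [volume_eq_sum_patternVolume hT.isCompact hB]
    refine Finset.sum_eq_zero fun p hp => ?_
    by_contra hp0
    exact hS ⟨p, Finset.mem_filter.2 ⟨hp, hp0⟩⟩
  have hapos : ∀ p, p.Nonempty → patternVolume T p ≠ 0 → 0 < a p := fun p hp hp0 =>
    ENNReal.toReal_pos hp0 (patternVolume_ne_top hT.isCompact hp)
  -- The least ratio `t` makes `w` nonnegative on all nonempty patterns, by translation invariance,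
  -- with `w p₀ = 0`.
  obtain ⟨p₀, hp₀, hmin⟩ := S.exists_min_image (fun p => L (a p) / a p) hS
  have hp₀' := Finset.mem_filter.1 hp₀
  have hp₀ne : p₀.Nonempty := ⟨0, (Finset.mem_filter.1 hp₀'.1).2⟩
  have ha₀ := hapos p₀ hp₀ne hp₀'.2
  let t := L (a p₀) / a p₀
  let w : Finset (Fin n → ℤ) → ℝ := fun p => L (a p) - t * a p
  have hw₀ : w p₀ = 0 := by
    simp only [w, t]
    rw [div_mul_cancel₀ _ ha₀.ne', sub_self]
  have hwzero : ∀ p, patternVolume T p = 0 → w p = 0 := fun p hp => by simp [w, a, hp]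
  have hwtrans : ∀ p z, w (p.image (· - z)) = w p := fun p z => by
    simp only [w, a, patternVolume_image_sub hT.isCompact]
  have hwnonneg : ∀ p : Finset (Fin n → ℤ), p.Nonempty → 0 ≤ w p := by
    rintro p ⟨z, hz⟩
    by_cases hp : patternVolume T p = 0
    · rw [hwzero p hp]
    rw [← hwtrans p z]
    have hp' : patternVolume T (p.image (· - z)) ≠ 0 := by
      rwa [patternVolume_image_sub hT.isCompact]
    have hmem0 : 0 ∈ p.image (· - z) := Finset.mem_image.2 ⟨z, hz, sub_self z⟩
    have hpS : p.image (· - z) ∈ S := by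
      refine Finset.mem_filter.2 ⟨?_, hp'⟩
      obtain ⟨x, hx⟩ := exists_latticePattern_eq hp'
      rw [← hx] at hmem0 ⊢
      exact latticePattern_mem_of_zero_mem hB hmem0
    have := hmin _ hpS
    rw [le_div_iff₀ (hapos _ ⟨0, hmem0⟩ hp')] at this
    exact sub_nonneg.2 this
  refine ⟨t, fun q hq => sub_eq_zero.1 ?_⟩
  change w q = 0
  by_contra hwq
  have hwq' : 0 < w q := lt_of_le_of_ne (hwnonneg q hq) (Ne.symm hwq)
  -- By `ℚ`-linearity `w` solves the same integer system. Its terms are nonnegative, so a positive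
  -- value at `A x` forces one at `x`. The locus `w > 0` is not conull, because `p₀` has positive
  -- volume; if it is null, `q` has volume zero and `w q = 0`.
  have herg := hA.volume_eq_zero_or_compl
    (E := {x | latticePattern T x ∈ {p : Finset (Fin n → ℤ) | p.Nonempty ∧ 0 < w p}})
    (measurableSet_preimage_latticePattern hT.isCompact _)
    (fun x z => by
      simp only [Set.mem_ofPred_eq]
      rw [latticePattern_add_intVec hT.isCompact, hwtrans, Finset.image_nonempty])
    (by
      filter_upwards [hT.ae_latticePattern_nonempty hA h0] with x hx hMx
      refine ⟨hx, ?_⟩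
      obtain ⟨F, hF, hF', hsum⟩ := hT.exists_patternVolume_eq_sum hA hx
      have hmem := hF' _ (hT.isPatternStep hA x)
      have hwsum : ((|A.det| : ℤ) : ℝ) * w (latticePattern T x) = ∑ p ∈ F, w p := by
        have hL := congrArg L hsum
        have hsmul : ((|A.det| : ℤ) : ℝ) * (patternVolume T (latticePattern T x)).toReal =
            ((|A.det| : ℤ) : ℚ) • (patternVolume T (latticePattern T x)).toReal := by
          rw [Rat.smul_def]; push_cast; rfl
        rw [hsmul, map_smul, map_sum, Rat.smul_def] at hL
        simp only [w, a, Finset.sum_sub_distrib, ← Finset.mul_sum]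
        rw [← hL, ← hsum, Rat.cast_intCast]
        ring
      have h1 : 0 < ∑ p ∈ F, w p := lt_of_lt_of_le hMx.2
        (Finset.single_le_sum (fun p hp => hwnonneg p (hF p hp)) hmem)
      rw [← hwsum] at h1
      exact pos_of_mul_pos_right h1 (by positivity))
  rcases herg with h | h
  · refine hwq (hwzero q (measure_mono_null ?_ h))
    rintro x rfl
    exact ⟨hq, hwq'⟩
  · refine hp₀'.2 (measure_mono_null ?_ h)
    rintro x rfl hx
    exact hx.2.ne' hw₀

theorem exists_linearMap_rat_one : ∃ l : ℝ →ₗ[ℚ] ℚ, l 1 = 1 := by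
  obtain ⟨l, hl⟩ := LinearMap.exists_leftInverse_of_injective
    (LinearMap.toSpanSingleton ℚ ℝ 1) (by
      rw [LinearMap.ker_eq_bot]
      intro a b hab
      simpa [Rat.smul_def] using hab)
  exact ⟨l, by simpa using LinearMap.congr_fun hl 1⟩

theorem IsSelfAffineSet.exists_rat_patternVolume (hT : IsSelfAffineSet A D T)
    (hA : IsExpanding A) (h0 : volume T ≠ 0) {p : Finset (Fin n → ℤ)} (hp : p.Nonempty) :
    ∃ r : ℚ, (patternVolume T p).toReal = r := by
  obtain ⟨B, hB⟩ := exists_window hT.isCompact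
  obtain ⟨l, hl⟩ := exists_linearMap_rat_one
  let L : ℝ →ₗ[ℚ] ℝ := (LinearMap.toSpanSingleton ℚ ℝ 1).comp l
  have hL : ∀ x, L x = (l x : ℝ) := fun x => by simp [L, Rat.smul_def]
  obtain ⟨t, ht⟩ := hT.exists_forall_linearMap_patternVolume hA h0 L
  have hne : ∀ q ∈ B.powerset.filter (0 ∈ ·), q.Nonempty := fun q hq =>
    ⟨0, (Finset.mem_filter.1 hq).2⟩
  have hsum : ∑ q ∈ B.powerset.filter (0 ∈ ·),
      ((q.card : ℚ)⁻¹) • (patternVolume T q).toReal = 1 := by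
    have h := congrArg ENNReal.toReal (sum_patternVolume_div_card hT.isCompact hB
      (hT.ae_latticePattern_nonempty hA h0))
    rw [ENNReal.toReal_sum] at h
    · rw [← ENNReal.toReal_one, ← h]
      refine Finset.sum_congr rfl fun q _ => ?_
      rw [ENNReal.toReal_mul, ENNReal.toReal_inv, ENNReal.toReal_natCast, Rat.smul_def]
      push_cast
      rfl
    · intro q hq
      refine ENNReal.mul_ne_top ?_ (patternVolume_ne_top hT.isCompact (hne q hq))
      simpa using (hne q hq).ne_empty
  -- `L` fixes `1`, and the normalization writes `1` as a rational combination of volumes, on which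
  -- `L` is multiplication by `t`.
  have ht1 : t = 1 := by
    have h := congrArg L hsum
    rw [map_sum, hL 1, hl] at h
    have h2 : ∑ q ∈ B.powerset.filter (0 ∈ ·), L (((q.card : ℚ)⁻¹) • (patternVolume T q).toReal) =
        t * ∑ q ∈ B.powerset.filter (0 ∈ ·), ((q.card : ℚ)⁻¹) • (patternVolume T q).toReal := by
      rw [Finset.mul_sum]
      refine Finset.sum_congr rfl fun q hq => ?_
      rw [map_smul, ht q (hne q hq), mul_smul_comm]
    rw [h2, hsum] at h
    simpa using h
  refine ⟨l (patternVolume T p).toReal, ?_⟩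
  rw [← hL, ht p hp, ht1, one_mul]

theorem IsSelfAffineSet.exists_rat_volume (hT : IsSelfAffineSet A D T) (hA : IsExpanding A) :
    ∃ q : ℚ, 0 ≤ q ∧ volume T = ENNReal.ofReal (q : ℝ) := by
  by_cases h0 : volume T = 0
  · exact ⟨0, le_rfl, by simp [h0]⟩
  obtain ⟨B, hB⟩ := exists_window hT.isCompact
  choose! r hr using fun (p : Finset (Fin n → ℤ)) (hp : p.Nonempty) =>
    hT.exists_rat_patternVolume hA h0 hp
  have hne : ∀ q ∈ B.powerset.filter (0 ∈ ·), q.Nonempty := fun q hq =>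
    ⟨0, (Finset.mem_filter.1 hq).2⟩
  have hvol : (volume T).toReal = ((∑ p ∈ B.powerset.filter (0 ∈ ·), r p : ℚ) : ℝ) := by
    rw [volume_eq_sum_patternVolume hT.isCompact hB, ENNReal.toReal_sum fun p hp =>
      patternVolume_ne_top hT.isCompact (hne p hp)]
    push_cast
    exact Finset.sum_congr rfl fun p hp => hr p (hne p hp)
  refine ⟨∑ p ∈ B.powerset.filter (0 ∈ ·), r p, ?_, ?_⟩
  · have : (0 : ℝ) ≤ ((∑ p ∈ B.powerset.filter (0 ∈ ·), r p : ℚ) : ℝ) :=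
      hvol ▸ ENNReal.toReal_nonneg
    exact_mod_cast this
  · rw [← hvol, ENNReal.ofReal_toReal hT.isCompact.measure_lt_top.ne]

end Pattern

theorem mainTheorem2 (n : ℕ) (A : Matrix (Fin n) (Fin n) ℤ) (hA : IsExpanding A)
    (D : Finset (Fin n → ℤ)) (hD : D.Nonempty) :
    (∃! T : Set (Fin n → ℝ), IsSelfAffineSet A D T) ∧
      ∀ T : Set (Fin n → ℝ), IsSelfAffineSet A D T →
        ∃ q : ℚ, 0 ≤ q ∧ volume T = ENNReal.ofReal (q : ℝ) :=
  ⟨hA.existsUnique_isSelfAffineSet hD, fun _ hT => hT.exists_rat_volume hA⟩
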